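/- **Proposition 1.2.** Let $G$ be an algebraic group over $\mathbb C$ (a group scheme of finite type, not necessarily affine or connected), let $H\subset G$ be a closed subgroup such that the homogeneous space $X=G/H$ is quasi-projective, let $Z$ be an irreducible variety over $\mathbb C$ and $u:Z\to X$ a morphism. Points are complex points, and $\tau_g:X\to X$ denotes the left action (translation) of $g\in G$. A *$Z$-chain of length $r\ge 1$* consists of points $a_i,b_i\in Z$ and translations $\tau_i=\tau_{g_i}$ with $g_i\in G$ $(i=1,\dots,r)$ such that $\tau_i(u(b_i))=\tau_{i+1}(u(a_{i+1}))$ for $1\le i\le r-1$; it connects $x_1$ to $x_2$ if $x_1=\tau_1(u(a_1))$ and $x_2=\tau_r(u(b_r))$. By convention, the empty chain of length $0$ connects every point of $X$ to itself and to no other point. Then there is a Zariski closed subgroup $K$ with $H\subset K\subset G$ such that, for all $x_1,x_2\in X$, there is a $Z$-chain of some length $r\ge 1$ connecting $x_1$ to $x_2$ if and only if $x_1$ and $x_2$ lie in the same fiber of the natural projection $p_K:G/H\to G/K$. Furthermore, in this case $x_1$ and $x_2$ can be connected by a $Z$-chain of length $\le 2(\dim K-\dim H)$. -/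

import Mathlib

open AlgebraicGeometry CategoryTheory MonoidalCategory CartesianMonoidalCategory MonObj
open scoped MonoidalLeftAction Topology

noncomputable section

namespace ChainsInHomogeneousSpaces

/-- Schemes over `ℂ`. -/
abbrev SchC : Type 1 := Over (Spec (CommRingCat.of ℂ))

/-- The set `X(ℂ)` of complex points of a scheme `X` over `ℂ`. For a group scheme `G` this is a
group, and if `G` acts on `X` then `G(ℂ)` acts on `X(ℂ)` (both are instances in Mathlib). -/
abbrev Pts (X : SchC) : Type := 𝟙_ SchC ⟶ X

/-- The point of the underlying topological space of `X` given by a complex point. -/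
def Pts.toPoint {X : SchC} (x : Pts X) : X.left :=
  x.left (IsLocalRing.closedPoint ℂ : Spec (CommRingCat.of ℂ))

/-- The Zariski topology on `X(ℂ)`. -/
abbrev zariskiTopology (X : SchC) : TopologicalSpace (Pts X) :=
  TopologicalSpace.induced Pts.toPoint inferInstance

/-- The dimension (Krull dimension for the Zariski topology) of a set of complex points. -/
def zariskiDim {X : SchC} (S : Set (Pts X)) : WithBot ℕ∞ :=
  letI := zariskiTopology X
  topologicalKrullDim S

attribute [local instance] MvPolynomial.gradedAlgebra

/-- Projective `n`-space over `ℂ`, as `Proj ℂ[x₀, …, xₙ]`. -/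
def projectiveSpace (n : ℕ) : SchC :=
  Over.mk (Proj.toSpecZero (MvPolynomial.homogeneousSubmodule (Fin (n + 1)) ℂ) ≫
    Spec.map (CommRingCat.ofHom
      (algebraMap ℂ (MvPolynomial.homogeneousSubmodule (Fin (n + 1)) ℂ 0))))

/-- `X` is quasi-projective: it is isomorphic to a locally closed subscheme of some `ℙⁿ`. -/
def IsQuasiProjective (X : SchC) : Prop :=
  ∃ (n : ℕ) (i : X ⟶ projectiveSpace n), IsImmersion i.left

/-- `G` is an algebraic group over `ℂ`: a group scheme of finite type. It is automatically
separated and smooth; it need not be affine or connected. -/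
class IsAlgebraicGroup (G : SchC) [GrpObj G] : Prop where
  locallyOfFiniteType : LocallyOfFiniteType G.hom
  quasiCompact : QuasiCompact G.hom

/-- `Z` is an irreducible variety over `ℂ`. -/
class IsIrreducibleVariety (Z : SchC) : Prop where
  isIntegral : IsIntegral Z.left
  isSeparated : IsSeparated Z.hom
  locallyOfFiniteType : LocallyOfFiniteType Z.hom
  quasiCompact : QuasiCompact Z.hom

/-- `X` is the homogeneous space `G/H` with base point `o = eH`: the scheme `X` is reduced, `G`
acts on it, transitively on complex points, and `H` is the stabilizer of `o`. (In characteristic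
zero the orbit map `G ⟶ X` of `o` is then the quotient morphism `G ⟶ G/H`.) -/
structure IsHomogeneousSpace (G X : SchC) [GrpObj G] [ModObj G X]
    (H : Subgroup (Pts G)) (o : Pts X) : Prop where
  isReduced : IsReduced X.left
  transitive : MulAction.IsPretransitive (Pts G) (Pts X)
  stabilizer_eq : MulAction.stabilizer (Pts G) o = H

section

variable {G X : SchC} [GrpObj G] [ModObj G X] {H : Subgroup (Pts G)} {o : Pts X}

/-- The identification of the complex points of `X = G/H` with the cosets of `H`,
sending `g • o` to `gH`. -/
def IsHomogeneousSpace.cosetEquiv (hX : IsHomogeneousSpace G X H o) : Pts X ≃ Pts G ⧸ H :=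
  letI := hX.transitive
  ((Equiv.Set.univ (Pts X)).symm.trans
    (Equiv.setCongr (MulAction.orbit_eq_univ (Pts G) o).symm)).trans
    ((MulAction.orbitEquivQuotientStabilizer (Pts G) o).trans
      (Subgroup.quotientEquivOfEq hX.stabilizer_eq))

theorem IsHomogeneousSpace.cosetEquiv_smul (hX : IsHomogeneousSpace G X H o) (g : Pts G) :
    hX.cosetEquiv (g • o) = (g : Pts G ⧸ H) := by
  rw [← Equiv.eq_symm_apply]
  rfl

/-- The natural projection `p_K : G/H → G/K` for `H ≤ K`, on complex points. -/
def IsHomogeneousSpace.proj (hX : IsHomogeneousSpace G X H o) {K : Subgroup (Pts G)}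
    (hHK : H ≤ K) (x : Pts X) : Pts G ⧸ K :=
  Subgroup.quotientMapOfLE hHK (hX.cosetEquiv x)

/-- The point `τ_g(u(z))` of `X`. -/
def translatePt {Z : SchC} (u : Z ⟶ X) (g : Pts G) (z : Pts Z) : Pts X :=
  g • (z ≫ u)

variable (G) in
/-- A `Z`-chain of length `r` over `X`: links `(aᵢ, bᵢ, τᵢ)` such that the end of each link is
the start of the next one. -/
structure ZChain {Z : SchC} (u : Z ⟶ X) (r : ℕ) where
  a : Fin r → Pts Z
  b : Fin r → Pts Z
  τ : Fin r → Pts G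
  link : ∀ i j : Fin r, (j : ℕ) = i + 1 → translatePt u (τ i) (b i) = translatePt u (τ j) (a j)

/-- The chain connects `x` to `y`: it starts at `x` and ends at `y`. The empty chain of length
`0` connects every point to itself and to no other point. -/
def ZChain.Connects {Z : SchC} {u : Z ⟶ X} {r : ℕ} (c : ZChain G u r) (x y : Pts X) : Prop :=
  (∀ i : Fin r, (i : ℕ) = 0 → translatePt u (c.τ i) (c.a i) = x) ∧
  (∀ i : Fin r, (i : ℕ) + 1 = r → translatePt u (c.τ i) (c.b i) = y) ∧
  (r = 0 → x = y)

end

end ChainsInHomogeneousSpaces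

end

open ChainsInHomogeneousSpaces

/-! Every point of `X` has the form `g • o`. Let `S` be the set of `g` with `g • o` in `u(Z)`
(`transporter`) and `T = S⁻¹ S`. A link joins `g₁ • o` to `g₂ • o` exactly when `g₁⁻¹ g₂ ∈ T`, so
chains of length `r` correspond to products of `r` elements of `T`, modulo `H`. What is needed is a
closed subgroup `K` containing `H` and `T` with `K ⊆ T ^ (2n) H` for some `n ≤ dim K - dim H`; this
is `exists_closed_subgroup`.

It follows the classical argument that irreducible constructible sets generate a closed group. Let
`A` be an irreducible closed subgroup of finite index in `H`, and write `S = S₁ H` with `S₁`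
irreducible and `A`-stable. Then `D = S₁⁻¹ S₁` is irreducible, constructible and contains `A`.
Multiply `A` by conjugates `h D h⁻¹`, `h ∈ H`, as long as the closure grows. Each growth raises the
dimension, so after some number `n` of steps the closure `M` of the product `Q` is a group
normalized by `H`, and `K = M H`. Each conjugate costs only one factor of `T`, because `S` is right
`H`-stable; so `Q ⊆ T ^ n H`. Since `Q` contains a dense open subset of `M`, `M = Q Q`, which gives
the factor 2.

The splitting `S = S₁ H` requires `S` to be irreducible modulo `H`. This comes from the
irreducibility of `u(Z)` and the openness of the orbit map (`isOpenMap_smul_pts`), itself a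
consequence of generic smoothness in characteristic zero and translation. -/

noncomputable section

namespace ChainsInHomogeneousSpaces

open TopologicalSpace Set Topology
open scoped Pointwise

/-! ### Irreducible and constructible sets in Noetherian spaces. -/

section Topology

variable {T : Type*} [TopologicalSpace T]

theorem isIrreducible_of_subset_closure {s t : Set T} (hs : IsIrreducible s) (hst : s ⊆ t)
    (ht : t ⊆ closure s) : IsIrreducible t := by
  rw [← isIrreducible_iff_closure]
  have : closure t = closure s :=
    (closure_minimal ht isClosed_closure).antisymm (closure_mono hst)
  rw [this]
  exact hs.closure

theorem isIrreducible_of_isInducing {Y : Type*} [TopologicalSpace Y] {f : T → Y}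
    (hf : IsInducing f) {s : Set T} (hs : IsIrreducible (f '' s)) : IsIrreducible s := by
  refine ⟨hs.nonempty.of_image, fun u v hu hv ⟨x, hx, hxu⟩ ⟨y, hy, hyv⟩ ↦ ?_⟩
  obtain ⟨U, hU, rfl⟩ := hf.isOpen_iff.1 hu
  obtain ⟨V, hV, rfl⟩ := hf.isOpen_iff.1 hv
  obtain ⟨_, ⟨z, hz, rfl⟩, hz'⟩ := hs.2 U V hU hV ⟨f x, ⟨x, hx, rfl⟩, hxu⟩ ⟨f y, ⟨y, hy, rfl⟩, hyv⟩
  exact ⟨z, hz, hz'⟩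

variable [NoetherianSpace T]

theorem NoetherianSpace.isConstructible_of_isOpen {s : Set T} (hs : IsOpen s) :
    IsConstructible s :=
  IsRetrocompact.isConstructible hs fun _ _ _ ↦ NoetherianSpace.isCompact _

theorem NoetherianSpace.isConstructible_of_isClosed {s : Set T} (hs : IsClosed s) :
    IsConstructible s :=
  .of_compl (isConstructible_of_isOpen hs.isOpen_compl)

theorem NoetherianSpace.isConstructible_preimage {Y : Type*} [TopologicalSpace Y] {f : T → Y}
    (hf : Continuous f) {s : Set Y} (hs : IsConstructible s) : IsConstructible (f ⁻¹' s) :=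
  hs.preimage hf fun _ _ _ ↦ fun _ _ _ ↦ NoetherianSpace.isCompact _

/-- A constructible subset of a Noetherian space is a finite union of locally closed subsets. -/
theorem NoetherianSpace.exists_finite_isLocallyClosed {s : Set T} (hs : IsConstructible s) :
    ∃ F : Set (Set T), F.Finite ∧ (∀ t ∈ F, IsLocallyClosed t) ∧ s = ⋃₀ F := by
  have : QuasiSeparatedSpace T := ⟨fun _ _ _ _ _ _ ↦ NoetherianSpace.isCompact _⟩
  have hb : IsTopologicalBasis (range fun U : Opens T ↦ (U : Set T)) := by
    refine isTopologicalBasis_of_isOpen_of_nhds ?_ fun a u ha hu ↦ ⟨u, ⟨⟨u, hu⟩, rfl⟩, ha, le_rfl⟩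
    rintro _ ⟨U, rfl⟩
    exact U.2
  induction s, hs using IsConstructible.induction_of_isTopologicalBasis
    (fun U : Opens T ↦ (U : Set T)) hb (fun _ ↦ NoetherianSpace.isCompact _) with
  | sdiff i s hs =>
    refine ⟨_, finite_singleton _, ?_, (sUnion_singleton _).symm⟩
    rintro t rfl
    rw [sdiff_eq]
    exact i.2.isLocallyClosed.inter
      (isOpen_biUnion fun j _ ↦ j.2).isClosed_compl.isLocallyClosed
  | union s _ t _ h₁ h₂ =>
    obtain ⟨F, hF, hF', rfl⟩ := h₁
    obtain ⟨F', hF₁, hF₂, rfl⟩ := h₂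
    exact ⟨F ∪ F', hF.union hF₁, fun t ht ↦ ht.elim (hF' t) (hF₂ t), (sUnion_union _ _).symm⟩

/-- An irreducible constructible set contains a nonempty open subset of its closure. -/
theorem NoetherianSpace.exists_isOpen_inter_closure_subset {s : Set T} (hs : IsConstructible s)
    (hi : IsIrreducible s) :
    ∃ U : Set T, IsOpen U ∧ (closure s ∩ U).Nonempty ∧ closure s ∩ U ⊆ s := by
  obtain ⟨F, hF, hF', rfl⟩ := exists_finite_isLocallyClosed hs
  -- The closures of the finitely many locally closed pieces cover the irreducible `s`, so a single
  -- piece `t` is dense in `s`; being locally closed, it is open in its closure.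
  obtain ⟨_, htc, hst⟩ := isIrreducible_iff_sUnion_isClosed.1 hi ((hF.image closure).toFinset)
    (by simp) (by
      rintro x ⟨t, ht, hx⟩
      exact ⟨closure t, by simpa using ⟨t, ht, rfl⟩, subset_closure hx⟩)
  obtain ⟨t, ht, rfl⟩ : ∃ t ∈ F, closure t = _ := by simpa using htc
  have htF : t ⊆ ⋃₀ F := subset_sUnion_of_mem ht
  have hcl : closure (⋃₀ F) = closure t :=
    (closure_minimal hst isClosed_closure).antisymm (closure_mono htF)
  obtain ⟨x, hx⟩ : t.Nonempty := by
    rw [← closure_nonempty_iff, ← hcl]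
    exact hi.nonempty.closure
  obtain ⟨U, hxU, hU, hUt⟩ := ((isLocallyClosed_tfae t).out 0 3 :
    IsLocallyClosed t ↔ ∀ x ∈ t, ∃ U, x ∈ U ∧ IsOpen U ∧ U ∩ closure t ⊆ t).1 (hF' t ht) x hx
  rw [hcl]
  exact ⟨U, hU, ⟨x, subset_closure hx, hxU⟩, fun y hy ↦ htF (hUt ⟨hy.2, hy.1⟩)⟩

/-- These are the irreducible components of the subspace `S`, with maximality phrased in the ambient
space so that products and translates can be compared with them. -/
theorem NoetherianSpace.exists_finite_maximal_irreducible (S : Set T) :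
    ∃ F : Set (Set T), F.Finite ∧ S = ⋃₀ F ∧
      ∀ t ∈ F, IsIrreducible t ∧ ∀ t', IsIrreducible t' → t ⊆ t' → t' ⊆ S → t' = t := by
  refine ⟨(fun t : Set S ↦ Subtype.val '' t) '' irreducibleComponents S,
    NoetherianSpace.finite_irreducibleComponents.image _, ?_, ?_⟩
  · ext x
    simp only [sUnion_image, mem_iUnion, mem_image, Subtype.exists, exists_and_right,
      exists_eq_right]
    exact ⟨fun hx ↦ ⟨irreducibleComponent ⟨x, hx⟩,
      irreducibleComponent_mem_irreducibleComponents _, hx, mem_irreducibleComponent⟩,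
      fun ⟨_, _, hx, _⟩ ↦ hx⟩
  · rintro _ ⟨t, ht, rfl⟩
    refine ⟨ht.1.image _ continuous_subtype_val.continuousOn, fun t' ht' hle hS ↦ ?_⟩
    refine subset_antisymm ?_ hle
    have h1 : IsIrreducible (Subtype.val ⁻¹' t' : Set S) :=
      isIrreducible_of_isInducing IsInducing.subtypeVal (by
        rwa [Subtype.image_preimage_coe, inter_eq_right.2 hS])
    have := ht.2 h1 (image_subset_iff.1 hle)
    rintro x hx
    exact ⟨⟨x, hS hx⟩, this hx, rfl⟩

end Topology

/-! ### Groups with separately continuous multiplication. -/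

section SemitopologicalGroup

variable {Γ : Type*} [Group Γ] [TopologicalSpace Γ]

theorem isIrreducible_inv [ContinuousInv Γ] {A : Set Γ} (hA : IsIrreducible A) :
    IsIrreducible A⁻¹ := by
  rw [← image_inv_eq_inv]
  exact hA.image _ continuous_inv.continuousOn

section

variable [SeparatelyContinuousMul Γ]

/-- Joint continuity fails for the Zariski topology, but one variable at a time suffices: choose `a`
so that both open conditions on `b` are nonempty, then choose `b`. -/
theorem isIrreducible_mul {A B : Set Γ} (hA : IsIrreducible A) (hB : IsIrreducible B) :
    IsIrreducible (A * B) := by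
  refine ⟨hA.nonempty.mul hB.nonempty, ?_⟩
  rintro u v hu hv ⟨_, ⟨a₁, ha₁, b₁, hb₁, rfl⟩, h₁⟩ ⟨_, ⟨a₂, ha₂, b₂, hb₂, rfl⟩, h₂⟩
  obtain ⟨a, ha, ha₁', ha₂'⟩ := hA.2 _ _ (hu.preimage (continuous_mul_const b₁))
    (hv.preimage (continuous_mul_const b₂)) ⟨a₁, ha₁, h₁⟩ ⟨a₂, ha₂, h₂⟩
  obtain ⟨b, hb, hb₁', hb₂'⟩ := hB.2 _ _ (hu.preimage (continuous_const_mul a))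
    (hv.preimage (continuous_const_mul a)) ⟨b₁, hb₁, ha₁'⟩ ⟨b₂, hb₂, ha₂'⟩
  exact ⟨a * b, mul_mem_mul ha hb, hb₁', hb₂'⟩

theorem isIrreducible_conj {A : Set Γ} (hA : IsIrreducible A) (h : Γ) :
    IsIrreducible ((fun g ↦ h * g * h⁻¹) '' A) :=
  hA.image _ ((continuous_mul_const h⁻¹).comp (continuous_const_mul h)).continuousOn

theorem isConstructible_conj [NoetherianSpace Γ] {A : Set Γ} (hA : IsConstructible A) (h : Γ) :
    IsConstructible ((fun g ↦ h * g * h⁻¹) '' A) := by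
  have : (fun g ↦ h * g * h⁻¹) '' A = (fun g ↦ h⁻¹ * g * h) ⁻¹' A := by
    ext g
    constructor
    · rintro ⟨a, ha, rfl⟩
      change h⁻¹ * (h * a * h⁻¹) * h ∈ A
      convert ha using 1
      group
    · intro hg
      exact ⟨_, hg, by group⟩
  rw [this]
  exact NoetherianSpace.isConstructible_preimage
    ((continuous_mul_const h).comp (continuous_const_mul h⁻¹)) hA

/-- Left translation of irreducible closed sets. -/
def translateIrreducibleCloseds (g : Γ) : IrreducibleCloseds Γ ≃o IrreducibleCloseds Γ where
  toFun C := ⟨(g⁻¹ * ·) ⁻¹' C, by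
    have : (g⁻¹ * ·) ⁻¹' (C : Set Γ) = (g * ·) '' C := by
      rw [image_mul_left]
    rw [this]
    exact C.isIrreducible.image _ (continuous_const_mul g).continuousOn,
    C.isClosed.preimage (continuous_const_mul _)⟩
  invFun C := ⟨(g * ·) ⁻¹' C, by
    have : (g * ·) ⁻¹' (C : Set Γ) = (g⁻¹ * ·) '' C := by
      rw [image_mul_left, inv_inv]
    rw [this]
    exact C.isIrreducible.image _ (continuous_const_mul g⁻¹).continuousOn,
    C.isClosed.preimage (continuous_const_mul _)⟩
  left_inv C := by
    ext x
    simp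
  right_inv C := by
    ext x
    simp
  map_rel_iff' {C D} := by
    refine ⟨fun h x hx ↦ ?_, fun h x hx ↦ h hx⟩
    have := @h (g * x) (by change g⁻¹ * (g * x) ∈ C; simpa using hx)
    change g⁻¹ * (g * x) ∈ D at this
    simpa using this

variable [ContinuousInv Γ]

/-- The closure of a subgroup, for a multiplication that is only separately continuous. -/
def closureSubgroup (L : Subgroup Γ) : Subgroup Γ where
  carrier := closure L
  one_mem' := subset_closure L.one_mem
  inv_mem' {x} hx := map_mem_closure continuous_inv hx fun _ h ↦ L.inv_mem h
  mul_mem' {x y} hx hy := by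
    have h1 : ∀ a ∈ L, a * y ∈ closure (L : Set Γ) := fun a ha ↦
      map_mem_closure (continuous_const_mul a) hy fun _ h ↦ L.mul_mem ha h
    have := map_mem_closure (continuous_mul_const y) hx h1
    rwa [closure_closure] at this

/-- A closed subgroup of a Noetherian group contains an irreducible closed subgroup of finite
index. -/
theorem exists_irreducible_finiteIndex [NoetherianSpace Γ] {H : Subgroup Γ}
    (hH : IsClosed (H : Set Γ)) :
    ∃ A : Subgroup Γ, A ≤ H ∧ IsIrreducible (A : Set Γ) ∧ IsClosed (A : Set Γ) ∧
      ∃ F : Set Γ, F.Finite ∧ F ⊆ H ∧ ∀ h ∈ H, ∃ f ∈ F, f⁻¹ * h ∈ A := by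
  obtain ⟨F, hF, hFH, hmax⟩ := NoetherianSpace.exists_finite_maximal_irreducible (H : Set Γ)
  obtain ⟨A, hA, h1⟩ : ∃ A ∈ F, (1 : Γ) ∈ A := by
    have : (1 : Γ) ∈ ⋃₀ F := hFH ▸ H.one_mem
    simpa using this
  have hAH : A ⊆ H := hFH ▸ subset_sUnion_of_mem hA
  obtain ⟨hAi, hAm⟩ := hmax A hA
  -- `A * B` is irreducible and contains both `A` and `B`, so the maximality of `A` absorbs `B`.
  have key : ∀ B : Set Γ, IsIrreducible B → 1 ∈ B → B ⊆ H → B ⊆ A := by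
    intro B hB hB1 hBH
    have := hAm (A * B) (isIrreducible_mul hAi hB) (fun a ha ↦ ⟨a, ha, 1, hB1, mul_one a⟩)
      (by rintro _ ⟨a, ha, b, hb, rfl⟩; exact H.mul_mem (hAH ha) (hBH hb))
    rw [← this]
    exact fun b hb ↦ ⟨1, h1, b, hb, one_mul b⟩
  have hAA : A * A ⊆ A := by
    refine (hAm (A * A) (isIrreducible_mul hAi hAi) (fun a ha ↦ ⟨a, ha, 1, h1, mul_one a⟩)
      ?_).subset
    rintro _ ⟨a, ha, b, hb, rfl⟩
    exact H.mul_mem (hAH ha) (hAH hb)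
  refine ⟨⟨⟨⟨A, fun ha hb ↦ hAA (mul_mem_mul ha hb)⟩, h1⟩, fun {x} hx ↦ ?_⟩, hAH, hAi, ?_, ?_⟩
  · refine key A⁻¹ (isIrreducible_inv hAi) (by simpa using h1) ?_ (by simpa using hx)
    intro y hy
    simpa using H.inv_mem (hAH hy)
  · refine isClosed_of_closure_subset ?_
    exact key _ hAi.closure (subset_closure h1) (closure_minimal hAH hH)
  · have hne : ∀ B ∈ F, B.Nonempty := fun B hB ↦ (hmax B hB).1.nonempty
    choose! f hf using hne
    refine ⟨f '' F, hF.image _, ?_, ?_⟩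
    · rintro _ ⟨B, hB, rfl⟩
      exact hFH ▸ subset_sUnion_of_mem hB (hf B hB)
    · intro h hh
      obtain ⟨B, hB, hhB⟩ : ∃ B ∈ F, h ∈ B := by
        have : h ∈ ⋃₀ F := hFH ▸ hh
        simpa using this
      have hBH : B ⊆ H := hFH ▸ subset_sUnion_of_mem hB
      refine ⟨f B, mem_image_of_mem _ hB, ?_⟩
      refine key (((f B)⁻¹ * ·) '' B)
        ((hmax B hB).1.image _ (continuous_const_mul _).continuousOn) ⟨f B, hf B hB, by simp⟩ ?_
        ⟨h, hhB, rfl⟩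
      rintro _ ⟨b, hb, rfl⟩
      exact H.mul_mem (H.inv_mem (hBH (hf B hB))) (hBH hb)

end

end SemitopologicalGroup

/-! ### Dimension counting and generation of closed subgroups. -/

/-- Dimension growth is tracked by heights of irreducible closed sets of the ambient group; this
bound and the next one convert heights into Krull dimensions. -/
theorem height_le_topologicalKrullDim {T : Type*} [TopologicalSpace T] (C : IrreducibleCloseds T)
    {K : Set T} (hC : (C : Set T) ⊆ K) :
    (Order.height C : WithBot ℕ∞) ≤ topologicalKrullDim K := by
  rw [Order.height_eq_krullDim_Iic]
  have hsub : ∀ D : Iic C, (D.1 : Set T) ⊆ K := fun D ↦ Subset.trans D.2 hC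
  refine Order.krullDim_le_of_strictMono (fun D : Iic C ↦
    (⟨Subtype.val ⁻¹' (D.1 : Set T), isIrreducible_of_isInducing IsInducing.subtypeVal ?_,
      D.1.isClosed.preimage continuous_subtype_val⟩ : IrreducibleCloseds K)) ?_
  · rw [Subtype.image_preimage_coe, inter_eq_right.2 (hsub D)]
    exact D.1.isIrreducible
  · intro D E hDE
    refine lt_of_le_not_ge (fun x hx ↦ hDE.le hx) fun h ↦ hDE.not_ge fun x hx ↦ ?_
    exact h (show (⟨x, hsub E hx⟩ : K) ∈ _ from hx)

section

variable {Γ : Type*} [Group Γ] [TopologicalSpace Γ] [SeparatelyContinuousMul Γ]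

/-- The closure of an irreducible subset of `H` lies in one of the finitely many translates of `A`,
all of which have the height of `A`. -/
theorem topologicalKrullDim_le_height (H : Set Γ) (A : IrreducibleCloseds Γ) (F : Set Γ)
    (hF : F.Finite) (hFH : ∀ h ∈ H, ∃ f ∈ F, f⁻¹ * h ∈ A) :
    topologicalKrullDim H ≤ (Order.height A : WithBot ℕ∞) := by
  rw [topologicalKrullDim, Order.krullDim_eq_iSup_height]
  refine iSup_le fun Z ↦ WithBot.coe_le_coe.2 ?_
  refine (Order.height_le_height_apply_of_strictMono _
    (IrreducibleCloseds.map_strictMono_of_isInducing IsInducing.subtypeVal) Z).trans ?_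
  set Z' := IrreducibleCloseds.map (Subtype.val : H → Γ) IsInducing.subtypeVal.continuous Z
  obtain ⟨_, hD, hZD⟩ := isIrreducible_iff_sUnion_isClosed.1 Z'.isIrreducible
    ((hF.image fun f ↦ (translateIrreducibleCloseds f A : Set Γ)).toFinset)
    (by
      intro D hD
      obtain ⟨f, -, rfl⟩ : ∃ f ∈ F, (translateIrreducibleCloseds f A : Set Γ) = D := by
        simpa using hD
      exact (translateIrreducibleCloseds f A).isClosed) (by
      refine closure_minimal ?_ ?_
      · rintro _ ⟨h, -, rfl⟩
        obtain ⟨f, hf, hfA⟩ := hFH h h.2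
        exact ⟨_, by simpa using ⟨f, hf, rfl⟩, hfA⟩
      · rw [sUnion_eq_biUnion]
        refine (Finset.finite_toSet _).isClosed_biUnion ?_
        intro D hD
        obtain ⟨f, -, rfl⟩ : ∃ f ∈ F, (translateIrreducibleCloseds f A : Set Γ) = D := by
          simpa using hD
        exact (translateIrreducibleCloseds f A).isClosed)
  obtain ⟨f, -, rfl⟩ : ∃ f ∈ F, (translateIrreducibleCloseds f A : Set Γ) = _ := by
    simpa using hD
  rw [← Order.height_orderIso (translateIrreducibleCloseds f) A]
  exact Order.height_mono hZD

variable [NoetherianSpace Γ]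

/-- If `S` is right `H`-stable and irreducible modulo `H`, then `S = S₁ H` with `S₁` irreducible
and stable under a subgroup `A` of finite index in `H`. -/
theorem exists_irreducible_mul_eq {H A : Subgroup Γ} (hA : A ≤ H)
    (hAi : IsIrreducible (A : Set Γ)) {F : Set Γ} (hF : F.Finite) (hFH : F ⊆ H)
    (hFA : ∀ h ∈ H, ∃ f ∈ F, f⁻¹ * h ∈ A) {S : Set Γ} (hS : IsConstructible S)
    (hSH : S * H ⊆ S)
    (hirr : ∀ 𝒯 : Set (Set Γ), 𝒯.Finite → (∀ t ∈ 𝒯, t * (H : Set Γ) ⊆ t ∧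
      ∃ C, IsClosed C ∧ t = S ∩ C) → S ⊆ ⋃₀ 𝒯 → ∃ t ∈ 𝒯, S ⊆ t) :
    ∃ S₁ ⊆ S, IsIrreducible S₁ ∧ IsConstructible S₁ ∧ S₁ * A ⊆ S₁ ∧ S ⊆ S₁ * H := by
  obtain ⟨𝒮, h𝒮, hS𝒮, hmax⟩ := NoetherianSpace.exists_finite_maximal_irreducible S
  have hsub : ∀ t ∈ 𝒮, t ⊆ S := fun t ht ↦ hS𝒮 ▸ subset_sUnion_of_mem ht
  have hcl : ∀ t ∈ 𝒮, t = S ∩ closure t := fun t ht ↦ ((hmax t ht).2 _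
    (isIrreducible_of_subset_closure (hmax t ht).1 (subset_inter (hsub t ht) subset_closure)
      inter_subset_right) (subset_inter (hsub t ht) subset_closure) inter_subset_left).symm
  have hstab : ∀ t ∈ 𝒮, t * (A : Set Γ) ⊆ t := fun t ht ↦ ((hmax t ht).2 _
    (isIrreducible_mul (hmax t ht).1 hAi) (fun x hx ↦ ⟨x, hx, 1, A.one_mem, mul_one x⟩)
    ((mul_subset_mul (hsub t ht) hA).trans hSH)).subset
  -- The sets `t H` cover `S`. Each is closed in `S`: since `t` is `A`-stable, `t H` is the finite
  -- union of the translates `t f⁻¹` with `f ∈ F`.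
  obtain ⟨_, ⟨t, ht, rfl⟩, hSt⟩ := hirr ((fun t ↦ t * (H : Set Γ)) '' 𝒮) (h𝒮.image _) (by
      rintro _ ⟨t, ht, rfl⟩
      refine ⟨?_, ⋃ f ∈ F, (· * f) ⁻¹' closure t, hF.isClosed_biUnion fun f _ ↦
        isClosed_closure.preimage (continuous_mul_const f), ?_⟩
      · rintro _ ⟨_, ⟨x, hx, h, hh, rfl⟩, h', hh', rfl⟩
        exact ⟨x, hx, h * h', H.mul_mem hh hh', (_root_.mul_assoc _ _ _).symm⟩
      · ext x
        simp only [mem_inter_iff, mem_iUnion, mem_preimage, exists_prop]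
        constructor
        · rintro ⟨y, hy, h, hh, rfl⟩
          refine ⟨hSH (mul_mem_mul (hsub t ht hy) hh), ?_⟩
          obtain ⟨f, hf, hfA⟩ := hFA h⁻¹ (H.inv_mem hh)
          refine ⟨f, hf, subset_closure (hstab t ht ⟨y, hy, h * f, ?_, ?_⟩)⟩
          · simpa using A.inv_mem hfA
          · simp [_root_.mul_assoc]
        · rintro ⟨hx, f, hf, hxf⟩
          refine ⟨x * f, ?_, f⁻¹, H.inv_mem (hFH hf), by simp⟩
          rw [hcl t ht]
          exact ⟨hSH (mul_mem_mul hx (hFH hf)), hxf⟩) (by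
      intro x hx
      obtain ⟨t, ht, hxt⟩ : ∃ t ∈ 𝒮, x ∈ t := by
        have : x ∈ ⋃₀ 𝒮 := hS𝒮 ▸ hx
        simpa using this
      exact ⟨_, mem_image_of_mem _ ht, x, hxt, 1, H.one_mem, mul_one x⟩)
  refine ⟨t, hsub t ht, (hmax t ht).1, ?_, hstab t ht, hSt⟩
  rw [hcl t ht]
  exact hS.inter (NoetherianSpace.isConstructible_of_isClosed isClosed_closure)

/-- Let `S` be a constructible right `H`-stable subset, irreducible modulo `H`, of a Noetherian
semitopological group of finite dimension. Then `H` and `S⁻¹ S` generate a closed subgroup, each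
element of which is a product of a bounded number of elements of `S⁻¹ S` and one of `H`. -/
theorem exists_closed_subgroup [ContinuousInv Γ] (hdim : topologicalKrullDim Γ < ⊤)
    (hmul : ∀ A B : Set Γ, IsConstructible A → IsConstructible B → IsConstructible (A * B))
    {H : Subgroup Γ} (hH : IsClosed (H : Set Γ)) {S : Set Γ} (hS : IsConstructible S)
    (hSH : S * H ⊆ S)
    (hirr : ∀ 𝒯 : Set (Set Γ), 𝒯.Finite → (∀ t ∈ 𝒯, t * (H : Set Γ) ⊆ t ∧
      ∃ C, IsClosed C ∧ t = S ∩ C) → S ⊆ ⋃₀ 𝒯 → ∃ t ∈ 𝒯, S ⊆ t) :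
    ∃ K : Subgroup Γ, H ≤ K ∧ IsClosed (K : Set Γ) ∧ S⁻¹ * S ⊆ K ∧
      ∃ n : ℕ, topologicalKrullDim (H : Set Γ) + n ≤ topologicalKrullDim (K : Set Γ) ∧
        (K : Set Γ) ⊆ (S⁻¹ * S) ^ (2 * n) * H := by
  obtain ⟨A, hAH, hAi, hAc, F, hF, hFH, hFA⟩ := exists_irreducible_finiteIndex hH
  obtain ⟨S₁, hS₁S, hS₁i, hS₁c, hS₁A, hSS₁⟩ :=
    exists_irreducible_mul_eq hAH hAi hF hFH hFA hS hSH hirr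
  set T : Set Γ := S⁻¹ * S
  let D : Set Γ := S₁⁻¹ * S₁
  let conj : Γ → Set Γ := fun h ↦ (fun g ↦ h * g * h⁻¹) '' D
  have hAD : (A : Set Γ) ⊆ D := by
    intro a ha
    obtain ⟨s, hs⟩ := hS₁i.nonempty
    exact ⟨s⁻¹, by simpa using hs, s * a, hS₁A ⟨s, hs, a, ha, rfl⟩, by simp⟩
  have hDinv : ∀ d ∈ D, d⁻¹ ∈ D := by
    rintro _ ⟨x, hx, y, hy, rfl⟩
    exact ⟨y⁻¹, by simpa using hy, x⁻¹, hx, by simp⟩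
  have hDi : IsIrreducible D := isIrreducible_mul (isIrreducible_inv hS₁i) hS₁i
  have hDc : IsConstructible D :=
    hmul _ _ (NoetherianSpace.isConstructible_preimage continuous_inv hS₁c) hS₁c
  have hHD : ∀ h ∈ H, ∀ d ∈ D, h * d ∈ T := by
    rintro h hh _ ⟨x, hx, y, hy, rfl⟩
    refine ⟨h * x, ?_, y, hS₁S hy, _root_.mul_assoc _ _ _⟩
    simpa using hSH (mul_mem_mul (hS₁S hx) (H.inv_mem hh))
  -- Elements of `H` to the left of `d` are absorbed into `S⁻¹`, so a conjugate of `D` costs a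
  -- single factor of `T`.
  have hTconj : ∀ n : ℕ, ∀ g ∈ T ^ n * (H : Set Γ), ∀ h ∈ H, ∀ d ∈ conj h,
      g * d ∈ T ^ (n + 1) * (H : Set Γ) := by
    rintro n _ ⟨t, ht, k, hk, rfl⟩ h hh _ ⟨d, hd, rfl⟩
    refine ⟨t * (k * h * d), ?_, h⁻¹, H.inv_mem hh, by group⟩
    rw [pow_succ]
    exact mul_mem_mul ht (hHD _ (H.mul_mem hk hh) d hd)
  have hHT : ∀ n : ℕ, (H : Set Γ) * T ^ n ⊆ T ^ n * H := by
    rintro n _ ⟨h, hh, t, ht, rfl⟩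
    cases n with
    | zero => exact ⟨1, by simp, h, hh, by simp_all⟩
    | succ n =>
      rw [pow_succ'] at ht ⊢
      obtain ⟨_, ⟨x, hx, y, hy, rfl⟩, t', ht', rfl⟩ := ht
      have : h * x ∈ S⁻¹ := by simpa using hSH (mul_mem_mul hx (H.inv_mem hh))
      exact ⟨_, mul_mem_mul (mul_mem_mul this hy) ht', 1, H.one_mem,
        by simp [_root_.mul_assoc]⟩
  let L : Subgroup Γ := Subgroup.closure (⋃ h ∈ H, conj h)
  have hconjL : ∀ h ∈ H, conj h ⊆ L := fun h hh d hd ↦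
    Subgroup.subset_closure (mem_biUnion (show h ∈ (H : Set Γ) from hh) hd)
  have hLconj : ∀ h ∈ H, ∀ g ∈ L, h * g * h⁻¹ ∈ L := by
    intro h hh g hg
    induction hg using Subgroup.closure_induction with
    | mem x hx =>
      obtain ⟨k, hk, d, hd, rfl⟩ : ∃ k ∈ H, x ∈ conj k := by simpa using hx
      exact hconjL (h * k) (H.mul_mem hh hk) ⟨d, hd, by group⟩
    | one => simp
    | mul x y _ _ hx hy =>
      have := L.mul_mem hx hy
      convert this using 1
      group
    | inv x _ hx =>
      have := L.inv_mem hx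
      convert this using 1
      group
  have h1D : (1 : Γ) ∈ D := hAD A.one_mem
  have h1conj : ∀ h, (1 : Γ) ∈ conj h := fun h ↦ ⟨1, h1D, by simp⟩
  have hDL : D ⊆ L := fun d hd ↦ hconjL 1 H.one_mem ⟨d, hd, by simp⟩
  let A' : IrreducibleCloseds Γ := ⟨A, hAi, hAc⟩
  -- The number `n` of factors of `T` is paid for by the height of the closure; this is the source
  -- of the dimension bound.
  let good : ℕ → Set Γ → Prop := fun n Q ↦ IsConstructible Q ∧ (A : Set Γ) ⊆ Q ∧
    Q ⊆ T ^ n * (H : Set Γ) ∧ Q ⊆ L ∧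
    ∃ C : IrreducibleCloseds Γ, (C : Set Γ) = closure Q ∧ Order.height A' + n ≤ Order.height C
  have hfin : ∀ C : IrreducibleCloseds Γ, Order.height C < ⊤ := fun C ↦
    WithBot.coe_lt_coe.1 ((Order.height_le_krullDim C).trans_lt hdim)
  have h0 : good 0 A := ⟨NoetherianSpace.isConstructible_of_isClosed hAc, le_rfl,
    fun a ha ↦ ⟨1, by simp, a, hAH ha, one_mul a⟩, hAD.trans hDL, A', hAc.closure_eq.symm, by simp⟩
  obtain ⟨n, ⟨Q, hQ⟩, hn⟩ : ∃ n, (∃ Q, good n Q) ∧ ¬ ∃ Q, good (n + 1) Q := by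
    by_contra! hcon
    have hall : ∀ n, ∃ Q, good n Q := fun n ↦ by
      induction n with
      | zero => exact ⟨_, h0⟩
      | succ n ih => exact hcon n ih
    have hdim' : ∀ n : ℕ, (n : WithBot ℕ∞) ≤ topologicalKrullDim Γ := by
      intro n
      obtain ⟨Q, -, -, -, -, C, -, hC⟩ := hall n
      refine le_trans ?_ (Order.height_le_krullDim C)
      exact_mod_cast (le_add_self.trans hC)
    generalize topologicalKrullDim Γ = d at hdim hdim'
    induction d with
    | bot => simpa using hdim' 0
    | coe d =>
      lift d to ℕ using (WithBot.coe_lt_coe.1 hdim).ne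
      have : d + 1 ≤ d := by exact_mod_cast hdim' (d + 1)
      lia
  obtain ⟨hQc, hAQ, hQT, hQL, C, hCQ, hCn⟩ := hQ
  -- Otherwise `Q * conj h` has a strictly larger irreducible closure, hence height at least one
  -- more, against the choice of `n`.
  have hmax : ∀ h ∈ H, Q * conj h ⊆ C := by
    intro h hh
    by_contra hcon
    have hle : Q ⊆ Q * conj h := fun q hq ↦ ⟨q, hq, 1, h1conj h, mul_one q⟩
    have hQi : IsIrreducible Q := by
      rw [← isIrreducible_iff_closure, ← hCQ]
      exact C.isIrreducible
    let C' : IrreducibleCloseds Γ := ⟨closure (Q * conj h),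
      (isIrreducible_mul hQi (isIrreducible_conj hDi h)).closure, isClosed_closure⟩
    have hlt : C < C' := by
      refine lt_of_le_not_ge ?_ fun hge ↦ hcon (subset_closure.trans hge)
      change (C : Set Γ) ⊆ closure (Q * conj h)
      rw [hCQ]
      exact closure_mono hle
    refine hn ⟨Q * conj h, hmul _ _ hQc (isConstructible_conj hDc h), hAQ.trans hle, ?_, ?_, C',
      rfl, ?_⟩
    · rintro _ ⟨q, hq, d, hd, rfl⟩
      exact hTconj n q (hQT hq) h hh d hd
    · rintro _ ⟨q, hq, d, hd, rfl⟩
      exact L.mul_mem (hQL hq) (hconjL h hh hd)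
    · rw [Nat.cast_add, Nat.cast_one, ← _root_.add_assoc]
      exact (add_le_add_left hCn 1).trans
        (Order.add_one_le_of_lt (Order.height_strictMono hlt (hfin C)))
  have hLC : (C : Set Γ) = closure L := by
    refine subset_antisymm (hCQ ▸ closure_mono hQL) (closure_minimal ?_ C.isClosed)
    -- Inverses are carried along in the induction; for generators they are harmless because `D =
    -- D⁻¹`.
    have hmulC : ∀ g ∈ L, ∀ c ∈ C, c * g ∈ C ∧ c * g⁻¹ ∈ C := by
      have hc : ∀ h ∈ H, ∀ d ∈ conj h, ∀ c ∈ C, c * d ∈ C := by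
        intro h hh d hd c hcC
        have : c ∈ closure Q := hCQ ▸ hcC
        have := map_mem_closure (continuous_mul_const d) this
          (fun q hq ↦ hmax h hh (mul_mem_mul hq hd))
        rwa [C.isClosed.closure_eq] at this
      intro g hg
      induction hg using Subgroup.closure_induction with
      | mem x hx =>
        obtain ⟨k, hk, d, hd, rfl⟩ : ∃ k ∈ H, x ∈ conj k := by simpa using hx
        exact fun c hcC ↦ ⟨hc k hk _ ⟨d, hd, rfl⟩ c hcC,
          hc k hk _ ⟨d⁻¹, hDinv d hd, by group⟩ c hcC⟩
      | one => simp
      | mul x y _ _ hx hy =>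
        refine fun c hcC ↦ ⟨?_, ?_⟩
        · rw [← _root_.mul_assoc]
          exact (hy _ (hx c hcC).1).1
        · rw [mul_inv_rev, ← _root_.mul_assoc]
          exact (hx _ (hy c hcC).2).2
      | inv x _ hx => exact fun c hcC ↦ ⟨(hx c hcC).2, by simpa using (hx c hcC).1⟩
    intro g hg
    have h1C : (1 : Γ) ∈ C := by
      change (1 : Γ) ∈ (C : Set Γ)
      rw [hCQ]
      exact subset_closure (hAQ A.one_mem)
    simpa using (hmulC g hg 1 h1C).1
  let M : Subgroup Γ := closureSubgroup L
  have hMC : (M : Set Γ) = C := hLC.symm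
  have hMconj : ∀ h ∈ H, ∀ g ∈ M, h * g * h⁻¹ ∈ M := fun h hh g hg ↦
    map_mem_closure (f := fun x ↦ h * x * h⁻¹)
      ((continuous_mul_const h⁻¹).comp (continuous_const_mul h)) hg (hLconj h hh)
  let K : Subgroup Γ :=
    { carrier := (M : Set Γ) * H
      one_mem' := ⟨1, M.one_mem, 1, H.one_mem, mul_one 1⟩
      mul_mem' := by
        rintro _ _ ⟨m, hm, h, hh, rfl⟩ ⟨m', hm', h', hh', rfl⟩
        exact ⟨m * (h * m' * h⁻¹), M.mul_mem hm (hMconj h hh m' hm'), h * h', H.mul_mem hh hh',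
          by group⟩
      inv_mem' := by
        rintro _ ⟨m, hm, h, hh, rfl⟩
        exact ⟨h⁻¹ * m⁻¹ * h, by simpa using hMconj h⁻¹ (H.inv_mem hh) _ (M.inv_mem hm), h⁻¹,
          H.inv_mem hh, by group⟩ }
  have hLM : (L : Set Γ) ⊆ M := subset_closure
  have hAM : (A : Set Γ) ⊆ M := hAD.trans (hDL.trans hLM)
  refine ⟨K, fun h hh ↦ ⟨1, M.one_mem, h, hh, one_mul h⟩, ?_, ?_, n, ?_, ?_⟩
  -- As `A ⊆ M` has finite index in `H`, `K = M H` is a finite union of right translates of `M`.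
  · have : (K : Set Γ) = ⋃ f ∈ F, (· * f) ⁻¹' C := by
      ext x
      simp only [mem_iUnion, mem_preimage, exists_prop, ← hMC]
      constructor
      · rintro ⟨m, hm, h, hh, rfl⟩
        obtain ⟨f, hf, hfA⟩ := hFA h⁻¹ (H.inv_mem hh)
        refine ⟨f, hf, ?_⟩
        have := M.mul_mem hm (M.inv_mem (hAM hfA))
        simpa [_root_.mul_assoc] using this
      · rintro ⟨f, hf, hxf⟩
        exact ⟨x * f, hxf, f⁻¹, H.inv_mem (hFH hf), by simp⟩
    rw [this]
    exact hF.isClosed_biUnion fun f _ ↦ C.isClosed.preimage (continuous_mul_const f)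
  · rintro _ ⟨x, hx, y, hy, rfl⟩
    obtain ⟨s, hs, h, hh, hsx⟩ := hSS₁ hx
    obtain ⟨s', hs', h', hh', rfl⟩ := hSS₁ hy
    have hd : s⁻¹ * s' ∈ M := hLM (hDL ⟨s⁻¹, by simpa using hs, s', hs', rfl⟩)
    refine ⟨h⁻¹ * (s⁻¹ * s') * h, by simpa using hMconj h⁻¹ (H.inv_mem hh) _ hd, h⁻¹ * h',
      H.mul_mem (H.inv_mem hh) hh', ?_⟩
    obtain rfl : x = (s * h)⁻¹ := by
      simp only at hsx
      rw [hsx, inv_inv]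
    group
  · have hCK : (C : Set Γ) ⊆ K := fun c hc ↦ ⟨c, hMC ▸ hc, 1, H.one_mem, mul_one c⟩
    calc topologicalKrullDim (H : Set Γ) + n ≤ (Order.height A' : WithBot ℕ∞) + n :=
          add_le_add_left (topologicalKrullDim_le_height _ A' F hF hFA) _
      _ ≤ (Order.height C : WithBot ℕ∞) := by exact_mod_cast hCn
      _ ≤ topologicalKrullDim (K : Set Γ) := height_le_topologicalKrullDim C hCK
  · rintro _ ⟨m, hm, h, hh, rfl⟩
    have hQi : IsIrreducible Q := by
      rw [← isIrreducible_iff_closure, ← hCQ]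
      exact C.isIrreducible
    obtain ⟨U, hU, ⟨x, hxQ, hxU⟩, hUQ⟩ :=
      NoetherianSpace.exists_isOpen_inter_closure_subset hQc hQi
    rw [← hCQ, ← hMC] at hUQ hxQ
    -- The open sets `U` and `m U⁻¹` both meet the irreducible `M`, so they share a point `y` of
    -- `M`; then `y` and `y⁻¹ m` both lie in `Q`.
    have hV : IsOpen ((fun g ↦ g⁻¹ * m) ⁻¹' U) :=
      hU.preimage ((continuous_mul_const m).comp continuous_inv)
    obtain ⟨y, hyC, hyU, hyV⟩ := C.isIrreducible.2 U _ hU hV ⟨x, hMC ▸ hxQ, hxU⟩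
      ⟨m * x⁻¹, hMC ▸ M.mul_mem hm (M.inv_mem hxQ), by simpa using hxU⟩
    have hyM : y ∈ M := by
      rw [← hMC] at hyC
      exact hyC
    have hy1 := hQT (hUQ ⟨hyM, hyU⟩)
    have hy2 := hQT (hUQ ⟨M.mul_mem (M.inv_mem hyM) hm, hyV⟩)
    obtain ⟨t, ht, k, hk, htk⟩ := hy1
    obtain ⟨t', ht', k', hk', htk'⟩ := hy2
    obtain ⟨t₂, ht₂, k₂, hk₂, hk₂'⟩ := hHT n (mul_mem_mul hk ht')
    have hmem : k₂ * k' * h ∈ H := H.mul_mem (H.mul_mem hk₂ hk') hh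
    refine mem_mul.2 ⟨t * t₂, ?_, k₂ * k' * h, hmem, ?_⟩
    · rw [two_mul, pow_add]
      exact mul_mem_mul ht ht₂
    · have hm' : m = y * (y⁻¹ * m) := by simp
      simp only at htk htk' hk₂' ⊢
      rw [hm', ← htk', ← htk]
      calc t * t₂ * (k₂ * k' * h) = t * (t₂ * k₂) * k' * h := by group
        _ = _ := by rw [hk₂']; group

end

/-! ### The Zariski topology on complex points. -/

section Points

attribute [local instance] zariskiTopology

variable {X Y : SchC}

theorem isNoetherian_left (X : SchC) [LocallyOfFiniteType X.hom] [QuasiCompact X.hom] :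
    IsNoetherian X.left :=
  have : IsLocallyNoetherian ((Functor.fromPUnit (Spec (CommRingCat.of ℂ))).obj X.right) :=
    inferInstanceAs (IsLocallyNoetherian (Spec (CommRingCat.of ℂ)))
  have : CompactSpace ((Functor.fromPUnit (Spec (CommRingCat.of ℂ))).obj X.right) :=
    inferInstanceAs (CompactSpace (Spec (CommRingCat.of ℂ)))
  { toIsLocallyNoetherian := LocallyOfFiniteType.isLocallyNoetherian X.hom
    toCompactSpace := QuasiCompact.compactSpace_of_compactSpace X.hom }

theorem jacobsonSpace_left (X : SchC) [LocallyOfFiniteType X.hom] : JacobsonSpace X.left :=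
  have : JacobsonSpace ((Functor.fromPUnit (Spec (CommRingCat.of ℂ))).obj X.right) :=
    inferInstanceAs (JacobsonSpace (Spec (CommRingCat.of ℂ)))
  LocallyOfFiniteType.jacobsonSpace X.hom

theorem toPoint_comp (x : Pts X) (f : X ⟶ Y) : Pts.toPoint (x ≫ f) = f.left x.toPoint := by
  exact Scheme.Hom.comp_apply x.left f.left _

theorem continuous_comp (f : X ⟶ Y) : Continuous fun x : Pts X ↦ x ≫ f := by
  refine continuous_induced_rng.2 ?_
  have : Pts.toPoint ∘ (fun x : Pts X ↦ x ≫ f) = f.left ∘ Pts.toPoint := by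
    funext x
    exact toPoint_comp x f
  rw [this]
  exact f.left.continuous.comp continuous_induced_dom

theorem left_comp_hom (x : Pts X) : x.left ≫ X.hom = 𝟙 _ := Over.w x

theorem toPoint_injective [LocallyOfFiniteType X.hom] :
    Function.Injective (Pts.toPoint : Pts X → X.left) := by
  intro x y h
  refine Over.OverMorphism.ext ?_
  exact ext_of_apply_closedPoint_eq X.hom (left_comp_hom x) (left_comp_hom y) h

theorem exists_toPoint_eq [LocallyOfFiniteType X.hom] {p : X.left} (hp : IsClosed {p}) :
    ∃ x : Pts X, x.toPoint = p :=
  ⟨Over.homMk (pointOfClosedPoint X.hom p hp) (pointOfClosedPoint_comp X.hom p hp),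
    pointOfClosedPoint_apply X.hom p hp _⟩

theorem isClosed_toPoint [LocallyOfFiniteType X.hom] (x : Pts X) : IsClosed {x.toPoint} :=
  (pointEquivClosedPoint X.hom ⟨x.left, left_comp_hom x⟩).2

theorem noetherianSpace_pts (X : SchC) [LocallyOfFiniteType X.hom] [QuasiCompact X.hom] :
    NoetherianSpace (Pts X) :=
  have := isNoetherian_left X
  (IsInducing.mk rfl : IsInducing (Pts.toPoint : Pts X → X.left)).noetherianSpace

theorem isConstructible_pts_iff [LocallyOfFiniteType X.hom] [QuasiCompact X.hom]
    {s : Set (Pts X)} :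
    IsConstructible s ↔ ∃ t : Set X.left, IsConstructible t ∧ s = Pts.toPoint ⁻¹' t := by
  have := isNoetherian_left X
  have := noetherianSpace_pts X
  constructor
  · intro hs
    induction hs using IsConstructible.empty_union_induction with
    | open_retrocompact U hU _ =>
      obtain ⟨V, hV, rfl⟩ := isOpen_induced_iff.1 hU
      exact ⟨V, NoetherianSpace.isConstructible_of_isOpen hV, rfl⟩
    | union s _ t _ h₁ h₂ =>
      obtain ⟨s', hs', rfl⟩ := h₁
      obtain ⟨t', ht', rfl⟩ := h₂
      exact ⟨s' ∪ t', hs'.union ht', rfl⟩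
    | compl s _ h =>
      obtain ⟨s', hs', rfl⟩ := h
      exact ⟨s'ᶜ, hs'.compl, rfl⟩
  · rintro ⟨t, ht, rfl⟩
    exact NoetherianSpace.isConstructible_preimage continuous_induced_dom ht

theorem exists_isClosed_singleton_mem {T : Type*} [TopologicalSpace T] [NoetherianSpace T]
    [JacobsonSpace T] {s : Set T} (hs : IsConstructible s) (hne : s.Nonempty) :
    ∃ x ∈ s, IsClosed {x} := by
  obtain ⟨F, -, hF, rfl⟩ := NoetherianSpace.exists_finite_isLocallyClosed hs
  obtain ⟨x, t, ht, hx⟩ := hne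
  obtain ⟨y, hy, hyc⟩ := nonempty_inter_closedPoints ⟨x, hx⟩ (hF t ht)
  exact ⟨y, ⟨t, ht, hy⟩, hyc⟩

/-- Nullstellensatz: a nonempty constructible set `s ∩ f⁻¹(y)` in a Jacobson space contains a closed
point, which is a complex point. Chevalley's theorem thereby passes from schemes to complex points.
-/
theorem image_toPoint_preimage [LocallyOfFiniteType X.hom] [QuasiCompact X.hom]
    [LocallyOfFiniteType Y.hom] (f : X ⟶ Y) {s : Set X.left} (hs : IsConstructible s) :
    (fun x : Pts X ↦ x ≫ f) '' (Pts.toPoint ⁻¹' s) = Pts.toPoint ⁻¹' (f.left '' s) := by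
  have := isNoetherian_left X
  have := jacobsonSpace_left X
  ext y
  constructor
  · rintro ⟨x, hx, rfl⟩
    exact ⟨x.toPoint, hx, (toPoint_comp x f).symm⟩
  · rintro ⟨p, hp, hpy⟩
    obtain ⟨q, ⟨hq, hqy⟩, hqc⟩ := exists_isClosed_singleton_mem (hs.inter
      (NoetherianSpace.isConstructible_of_isClosed
        ((isClosed_toPoint y).preimage f.left.continuous))) ⟨p, hp, hpy⟩
    obtain ⟨x, rfl⟩ := exists_toPoint_eq hqc
    refine ⟨x, hq, toPoint_injective ?_⟩
    rw [toPoint_comp]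
    exact hqy

theorem isConstructible_image [LocallyOfFiniteType X.hom] [QuasiCompact X.hom]
    [LocallyOfFiniteType Y.hom] [QuasiCompact Y.hom] (f : X ⟶ Y) {s : Set (Pts X)}
    (hs : IsConstructible s) : IsConstructible ((fun x : Pts X ↦ x ≫ f) '' s) := by
  have := isNoetherian_left X
  have := isNoetherian_left Y
  obtain ⟨t, ht, rfl⟩ := isConstructible_pts_iff.1 hs
  have : LocallyOfFiniteType (f.left ≫ Y.hom) := by
    rw [Over.w f]
    infer_instance
  have : LocallyOfFiniteType f.left := locallyOfFiniteType_of_comp f.left Y.hom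
  exact isConstructible_pts_iff.2
    ⟨_, f.left.isConstructible_image ht, image_toPoint_preimage f ht⟩

theorem isIrreducible_univ_pts [LocallyOfFiniteType X.hom] [IrreducibleSpace X.left] :
    IsIrreducible (univ : Set (Pts X)) := by
  have := jacobsonSpace_left X
  refine isIrreducible_of_isInducing (f := Pts.toPoint) (IsInducing.mk rfl) ?_
  have : Pts.toPoint '' (univ : Set (Pts X)) = closedPoints X.left := by
    ext p
    constructor
    · rintro ⟨x, -, rfl⟩
      exact isClosed_toPoint x
    · intro hp
      obtain ⟨x, rfl⟩ := exists_toPoint_eq hp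
      exact ⟨x, trivial, rfl⟩
  rw [this, ← isIrreducible_iff_closure, closure_closedPoints]
  exact IrreducibleSpace.isIrreducible_univ _

theorem topologicalKrullDim_lt_top_of_finite_cover {T κ : Type*} [TopologicalSpace T] [Finite κ]
    {U : κ → Type*} [∀ i, TopologicalSpace (U i)] (f : ∀ i, U i → T)
    (hf : ∀ i, IsOpenEmbedding (f i)) (hU : ⋃ i, range (f i) = univ)
    (hdim : ∀ i, topologicalKrullDim (U i) < ⊤) :
    topologicalKrullDim T < ⊤ := by
  have hle : topologicalKrullDim T ≤ ⨆ i, topologicalKrullDim (U i) := by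
    -- Coheight, unlike height, is unchanged on passing to an open set that meets `Z`.
    rw [topologicalKrullDim, Order.krullDim_eq_iSup_coheight]
    refine iSup_le fun Z ↦ ?_
    obtain ⟨x, hx⟩ := Z.isIrreducible.nonempty
    obtain ⟨i, y, rfl⟩ : ∃ i, x ∈ range (f i) := by
      have : x ∈ ⋃ i, range (f i) := hU ▸ mem_univ x
      simpa using this
    obtain ⟨Z', hZ'⟩ := (IrreducibleCloseds.orderIsoOfIsOpenEmbedding _ (hf i)).surjective
      ⟨Z, ⟨y, hx⟩⟩
    have h : IrreducibleCloseds.map _ (hf i).continuous Z' = Z := congrArg Subtype.val hZ'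
    rw [← h, (hf i).coheight_map]
    exact (Order.coheight_le_krullDim _).trans
      (le_iSup (fun i ↦ topologicalKrullDim (U i)) i)
  refine hle.trans_lt ?_
  rcases isEmpty_or_nonempty κ with h | h
  · simp
  · obtain ⟨i, hi⟩ := exists_eq_ciSup_of_finite (f := fun i ↦ topologicalKrullDim (U i))
    rw [← hi]
    exact hdim i

theorem ringKrullDim_lt_top_of_finiteType {k R : Type*} [Field k] [CommRing R] [Algebra k R]
    [Algebra.FiniteType k R] : ringKrullDim R < ⊤ := by
  obtain ⟨n, f, hf⟩ := Algebra.FiniteType.iff_quotient_mvPolynomial''.1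
    (inferInstance : Algebra.FiniteType k R)
  refine (ringKrullDim_le_of_surjective f.toRingHom hf).trans_lt ?_
  rw [MvPolynomial.ringKrullDim_of_isNoetherianRing, ringKrullDim_eq_zero_of_field, zero_add]
  exact WithBot.coe_lt_coe.2 (ENat.natCast_lt_top (Nat.card (Fin n)))

theorem topologicalKrullDim_lt_top_of_isAffine {Y : Scheme} [IsAffine Y]
    (f : Y ⟶ Spec (CommRingCat.of ℂ)) [LocallyOfFiniteType f] : topologicalKrullDim Y < ⊤ := by
  have h : LocallyOfFiniteType (Spec.map (Spec.preimage (Y.isoSpec.inv ≫ f))) := by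
    rw [Spec.map_preimage]
    infer_instance
  have hft : (Spec.preimage (Y.isoSpec.inv ≫ f)).hom.FiniteType :=
    (HasRingHomProperty.Spec_iff (P := @LocallyOfFiniteType)).mp h
  algebraize [(Spec.preimage (Y.isoSpec.inv ≫ f)).hom]
  rw [Y.isoSpec.hom.homeomorph.isHomeomorph.topologicalKrullDim_eq]
  refine lt_of_eq_of_lt (PrimeSpectrum.topologicalKrullDim_eq_ringKrullDim Γ(Y, ⊤)) ?_
  exact ringKrullDim_lt_top_of_finiteType (k := ℂ)

theorem topologicalKrullDim_pts_lt_top (X : SchC) [LocallyOfFiniteType X.hom]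
    [QuasiCompact X.hom] : topologicalKrullDim (Pts X) < ⊤ := by
  have := isNoetherian_left X
  refine (IsInducing.topologicalKrullDim_le
    (IsInducing.mk rfl : IsInducing (Pts.toPoint : Pts X → X.left))).trans_lt ?_
  let 𝒰 := X.left.affineCover.finiteSubcover
  have : ∀ i, IsAffine (𝒰.X i) := fun i ↦ inferInstance
  exact topologicalKrullDim_lt_top_of_finite_cover (fun i ↦ 𝒰.f i)
    (fun i ↦ (𝒰.f i).isOpenEmbedding) 𝒰.iUnion_range
    fun i ↦ topologicalKrullDim_lt_top_of_isAffine (𝒰.f i ≫ X.hom)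

attribute [local instance] MvPolynomial.gradedAlgebra

theorem finiteType_homogeneousSubmodule_zero (n : ℕ) :
    Algebra.FiniteType (MvPolynomial.homogeneousSubmodule (Fin (n + 1)) ℂ 0)
      (MvPolynomial (Fin (n + 1)) ℂ) := by
  have : IsScalarTower ℂ (MvPolynomial.homogeneousSubmodule (Fin (n + 1)) ℂ 0)
      (MvPolynomial (Fin (n + 1)) ℂ) := by
    constructor
    intro a b c
    exact smul_mul_assoc a (b : MvPolynomial (Fin (n + 1)) ℂ) c
  exact Algebra.FiniteType.of_restrictScalars_finiteType ℂ _ _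

theorem locallyOfFiniteType_projectiveSpace (n : ℕ) :
    LocallyOfFiniteType (projectiveSpace n).hom := by
  have hsurj : Function.Surjective
      (algebraMap ℂ (MvPolynomial.homogeneousSubmodule (Fin (n + 1)) ℂ 0)) := by
    rintro ⟨p, hp⟩
    rw [MvPolynomial.mem_homogeneousSubmodule, ← MvPolynomial.totalDegree_zero_iff_isHomogeneous,
      MvPolynomial.totalDegree_eq_zero_iff_eq_C] at hp
    exact ⟨p.coeff 0, Subtype.ext hp.symm⟩
  have := finiteType_homogeneousSubmodule_zero n
  have h2 : LocallyOfFiniteType (Spec.map (CommRingCat.ofHom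
      (algebraMap ℂ (MvPolynomial.homogeneousSubmodule (Fin (n + 1)) ℂ 0)))) :=
    (HasRingHomProperty.Spec_iff (P := @LocallyOfFiniteType)).mpr
      (RingHom.FiniteType.of_surjective _ hsurj)
  dsimp [projectiveSpace]
  infer_instance

theorem quasiCompact_projectiveSpace (n : ℕ) : QuasiCompact (projectiveSpace n).hom := by
  have := finiteType_homogeneousSubmodule_zero n
  dsimp [projectiveSpace]
  infer_instance

/-- The embedding in projective space enters the argument through finiteness of type. -/
theorem IsQuasiProjective.locallyOfFiniteType (hX : IsQuasiProjective X) :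
    LocallyOfFiniteType X.hom := by
  obtain ⟨n, i, hi⟩ := hX
  have := locallyOfFiniteType_projectiveSpace n
  rw [← Over.w i]
  infer_instance

theorem IsQuasiProjective.quasiCompact (hX : IsQuasiProjective X) : QuasiCompact X.hom := by
  obtain ⟨n, i, hi⟩ := hX
  have := locallyOfFiniteType_projectiveSpace n
  have := quasiCompact_projectiveSpace n
  have := isNoetherian_left (projectiveSpace n)
  have := i.left.isEmbedding.isInducing.noetherianSpace
  infer_instance

end Points

/-! ### Generic smoothness and generic openness. -/

/-- A morphism that maps some point to a generic point maps a generic point to a generic point. -/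
theorem exists_closure_mem_irreducibleComponents {S T : Type*} [TopologicalSpace S]
    [TopologicalSpace T] [QuasiSober S] {f : S → T} (hf : Continuous f) {s : S}
    (hs : closure {f s} ∈ irreducibleComponents T) :
    ∃ x, closure {x} ∈ irreducibleComponents S ∧ closure {f x} ∈ irreducibleComponents T := by
  obtain ⟨x, hx⟩ := QuasiSober.sober (isIrreducible_irreducibleComponent (x := s))
    isClosed_irreducibleComponent
  refine ⟨x, hx ▸ irreducibleComponent_mem_irreducibleComponents s, ?_⟩
  have hsx : x ⤳ s := IsGenericPoint.specializes hx mem_irreducibleComponent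
  have h := (hsx.map hf).closure_subset
  have : closure {f x} = closure {f s} :=
    subset_antisymm (hs.2 isIrreducible_singleton.closure h) h
  rwa [this]

/-- At a generic point of `Y` over a generic point of `X` both stalks are fields, by reducedness,
and an extension of fields of characteristic zero is formally smooth. So the smooth locus is
nonempty, and smooth morphisms are open. -/
theorem exists_isOpenMap_of_isReduced {X Y : Scheme} [IsNoetherian X] [IsReduced X] [IsReduced Y]
    (g : X ⟶ Spec (CommRingCat.of ℂ)) (f : Y ⟶ X) [LocallyOfFiniteType f]
    {y : Y} (hy : closure {f y} ∈ irreducibleComponents X) :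
    ∃ V : Set Y, IsOpen V ∧ V.Nonempty ∧ ∀ W ⊆ V, IsOpen W → IsOpen (f '' W) := by
  have : IsLocallyNoetherian Y := LocallyOfFiniteType.isLocallyNoetherian f
  obtain ⟨x, hx, hfx⟩ := exists_closure_mem_irreducibleComponents f.continuous hy
  have hmem : x ∈ f.smoothLocus := by
    rw [Scheme.Hom.mem_smoothLocus]
    have hess := LocallyOfFiniteType.stalkMap f x
    let : Field (X.presheaf.stalk (f x)) :=
      (isField_stalk_of_closure_mem_irreducibleComponents X _ hfx).toField
    let : Field (Y.presheaf.stalk x) :=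
      (isField_stalk_of_closure_mem_irreducibleComponents Y _ hx).toField
    let φ : CommRingCat.of ℂ ⟶ X.presheaf.stalk (f x) :=
      (Scheme.ΓSpecIso _).inv ≫ g.appTop ≫ X.presheaf.germ ⊤ (f x) trivial
    have : CharZero (X.presheaf.stalk (f x)) := charZero_of_injective_ringHom φ.hom.injective
    algebraize [(f.stalkMap x).hom]
    exact Algebra.FormallySmooth.of_perfectField
  have hsm : Smooth (f.smoothLocus.ι ≫ f) := by
    rw [← Scheme.Hom.smoothLocus_eq_top_iff, ← Scheme.Hom.preimage_smoothLocus_eq]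
    simp
  refine ⟨f.smoothLocus, f.smoothLocus.isOpen, ⟨x, hmem⟩, fun W hW hWo ↦ ?_⟩
  have h := (f.smoothLocus.ι ≫ f).isOpenMap _ (hWo.preimage f.smoothLocus.ι.continuous)
  convert h using 1
  ext z
  constructor
  · rintro ⟨w, hw, rfl⟩
    exact ⟨⟨w, hW hw⟩, hw, rfl⟩
  · rintro ⟨w, hw, rfl⟩
    exact ⟨_, hw, rfl⟩

/-- Every point of a scheme has an open neighbourhood that is the homeomorphic image of a reduced
scheme. -/
theorem exists_isReduced_isOpenEmbedding {Y : Scheme} [IsLocallyNoetherian Y] (y : Y) :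
    ∃ (Y' : Scheme) (j : Y' ⟶ Y), IsReduced Y' ∧ LocallyOfFiniteType j ∧ IsOpenEmbedding j ∧
      y ∈ range j := by
  obtain ⟨V, hV, hyV, -⟩ := exists_isAffineOpen_mem_and_subset (U := ⊤) (x := y) trivial
  let q : Γ(Y, V) ⟶ CommRingCat.of (Γ(Y, V) ⧸ nilradical Γ(Y, V)) :=
    CommRingCat.ofHom (Ideal.Quotient.mk _)
  have hq : Function.Surjective q.hom := Ideal.Quotient.mk_surjective
  have hqc : IsClosedImmersion (Spec.map q) := IsClosedImmersion.spec_of_surjective _ hq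
  have hsurj : Function.Surjective (Spec.map q) :=
    (PrimeSpectrum.comap_quotientMk_bijective_of_le_nilradical le_rfl).2
  refine ⟨_, Spec.map q ≫ hV.fromSpec, ?_, inferInstance, ?_, ?_⟩
  · have : _root_.IsReduced (Γ(Y, V) ⧸ nilradical Γ(Y, V)) :=
      (Ideal.isRadical_iff_quotient_reduced _).1 (Ideal.radical_isRadical _)
    infer_instance
  · have h : IsOpenEmbedding (Spec.map q) :=
      ⟨(Spec.map q).isClosedEmbedding.isEmbedding, hsurj.range_eq ▸ isOpen_univ⟩
    convert hV.fromSpec.isOpenEmbedding.comp h using 1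
    ext
    simp
  · have : y ∈ range hV.fromSpec := by
      rw [hV.range_fromSpec]
      exact hyV
    obtain ⟨z, rfl⟩ := this
    obtain ⟨w, rfl⟩ := hsurj z
    exact ⟨w, rfl⟩

/-- The conclusion is purely topological, so `Y` can be replaced near `y` by a reduced scheme. For
the orbit map this removes the need to know that `G` is reduced. -/
theorem exists_isOpenMap_restrict {X Y : Scheme} [IsNoetherian X] [IsReduced X]
    (g : X ⟶ Spec (CommRingCat.of ℂ)) (f : Y ⟶ X) [LocallyOfFiniteType f]
    {y : Y} (hy : closure {f y} ∈ irreducibleComponents X) :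
    ∃ V : Set Y, IsOpen V ∧ V.Nonempty ∧ ∀ W ⊆ V, IsOpen W → IsOpen (f '' W) := by
  have : IsLocallyNoetherian Y := LocallyOfFiniteType.isLocallyNoetherian f
  obtain ⟨Y', j, _, _, hj, y', rfl⟩ := exists_isReduced_isOpenEmbedding y
  obtain ⟨V, hV, hVne, hVf⟩ := exists_isOpenMap_of_isReduced g (j ≫ f) (y := y') (by simpa using hy)
  refine ⟨j '' V, hj.isOpenMap V hV, hVne.image _, fun W hW hWo ↦ ?_⟩
  have h := hVf (j ⁻¹' W) (fun w hw ↦ (hj.injective.mem_set_image).1 (hW hw))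
    (hWo.preimage j.continuous)
  convert h using 1
  ext z
  constructor
  · rintro ⟨w, hw, rfl⟩
    obtain ⟨v, -, rfl⟩ := hW hw
    exact ⟨v, hw, by simp⟩
  · rintro ⟨v, hv, rfl⟩
    exact ⟨_, hv, by simp⟩

/-! ### The group of complex points and its orbit maps. -/

section OrbitMap

attribute [local instance] zariskiTopology

variable {G X : SchC} [GrpObj G]

theorem separatelyContinuousMul_pts (G : SchC) [GrpObj G] : SeparatelyContinuousMul (Pts G) where
  continuous_const_mul {g} := by
    convert continuous_comp ((toUnit G ≫ g) * 𝟙 G) using 2 with x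
    rw [MonObj.comp_mul, ← Category.assoc, Category.comp_id, toUnit_unique (x ≫ toUnit G) (𝟙 _),
      Category.id_comp]
  continuous_mul_const {g} := by
    convert continuous_comp (𝟙 G * (toUnit G ≫ g)) using 2 with x
    rw [MonObj.comp_mul, ← Category.assoc, Category.comp_id, toUnit_unique (x ≫ toUnit G) (𝟙 _),
      Category.id_comp]

theorem continuousInv_pts (G : SchC) [GrpObj G] : ContinuousInv (Pts G) where
  continuous_inv := by
    exact continuous_comp (ι : G ⟶ G)

/-- Chevalley's theorem for the multiplication morphism on `G ⊗ G`, whose complex points are pairs.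
-/
theorem isConstructible_mul_pts [LocallyOfFiniteType G.hom] [QuasiCompact G.hom]
    (A B : Set (Pts G)) (hA : IsConstructible A) (hB : IsConstructible B) :
    IsConstructible (A * B) := by
  have h1 : LocallyOfFiniteType (G ⊗ G).hom := by
    rw [Over.tensorObj_hom]
    infer_instance
  have h2 : QuasiCompact (G ⊗ G).hom := by
    rw [Over.tensorObj_hom]
    infer_instance
  have := noetherianSpace_pts (G ⊗ G)
  have hc : IsConstructible ((fun p : Pts (G ⊗ G) ↦ p ≫ fst G G) ⁻¹' A ∩
      (fun p : Pts (G ⊗ G) ↦ p ≫ snd G G) ⁻¹' B) :=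
    (NoetherianSpace.isConstructible_preimage (continuous_comp _) hA).inter
      (NoetherianSpace.isConstructible_preimage (continuous_comp _) hB)
  convert isConstructible_image (μ : G ⊗ G ⟶ G) hc using 1
  ext g
  constructor
  · rintro ⟨a, ha, b, hb, rfl⟩
    exact ⟨lift a b, ⟨by simpa using ha, by simpa using hb⟩, (Hom.mul_def a b).symm⟩
  · rintro ⟨p, ⟨hp1, hp2⟩, rfl⟩
    refine ⟨_, hp1, _, hp2, ?_⟩
    simp only [Hom.mul_def]
    congr 1
    ext <;> simp

variable [ModObj G X]

/-- The orbit map `G ⟶ X` of a point `o` of `X`. -/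
def orbitMap (o : Pts X) : G ⟶ X := (𝟙 G : G ⟶ G) • (toUnit G ≫ o)

theorem comp_orbitMap (o : Pts X) (g : Pts G) : g ≫ orbitMap o = g • o := by
  rw [orbitMap, ModObj.comp_smul, ← Category.assoc, Category.comp_id,
    toUnit_unique (g ≫ toUnit G) (𝟙 _), Category.id_comp]

theorem continuous_smul_pts (g : Pts G) : Continuous fun x : Pts X ↦ g • x := by
  convert continuous_comp ((toUnit X ≫ g) • 𝟙 X) using 2 with x
  rw [ModObj.comp_smul, ← Category.assoc, Category.comp_id, toUnit_unique (x ≫ toUnit X) (𝟙 _),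
    Category.id_comp]

theorem isClosed_singleton_pts [LocallyOfFiniteType X.hom] (x : Pts X) :
    IsClosed ({x} : Set (Pts X)) := by
  convert (isClosed_toPoint x).preimage continuous_induced_dom
  ext y
  exact toPoint_injective.eq_iff.symm

/-- The orbit map of a homogeneous space is open for the Zariski topology. -/
theorem isOpenMap_smul_pts [LocallyOfFiniteType G.hom] [QuasiCompact G.hom]
    [LocallyOfFiniteType X.hom] [QuasiCompact X.hom] [IsReduced X.left]
    [MulAction.IsPretransitive (Pts G) (Pts X)] (o : Pts X) :
    IsOpenMap fun g : Pts G ↦ g • o := by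
  have := isNoetherian_left X
  have := isNoetherian_left G
  have := jacobsonSpace_left X
  have := jacobsonSpace_left G
  have := separatelyContinuousMul_pts G
  let π : G ⟶ X := orbitMap o
  have : LocallyOfFiniteType (π.left ≫ X.hom) := by
    rw [Over.w π]
    infer_instance
  have : LocallyOfFiniteType π.left := locallyOfFiniteType_of_comp π.left X.hom
  -- The complement of the image is constructible, so if nonempty it contains a closed point,
  -- against transitivity on complex points. In particular a generic point of `X` is hit.
  have hsurj : ∀ p : X.left, p ∈ range π.left := by
    by_contra! h
    have hc : IsConstructible (range π.left)ᶜ := by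
      rw [← image_univ]
      exact (π.left.isConstructible_image .univ).compl
    obtain ⟨q, hq, hqc⟩ := exists_isClosed_singleton_mem hc h
    obtain ⟨x, rfl⟩ := exists_toPoint_eq hqc
    obtain ⟨g, rfl⟩ := MulAction.exists_smul_eq (Pts G) o x
    exact hq ⟨g.toPoint, by rw [← toPoint_comp, comp_orbitMap]⟩
  obtain ⟨ξ, hξ⟩ := QuasiSober.sober (isIrreducible_irreducibleComponent (x := o.toPoint))
    isClosed_irreducibleComponent
  obtain ⟨c, rfl⟩ := hsurj ξ
  obtain ⟨V, hV, hVne, hVf⟩ := exists_isOpenMap_restrict X.hom π.left (y := c)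
    (hξ ▸ irreducibleComponent_mem_irreducibleComponents _)
  obtain ⟨_, hvV, hvc⟩ := nonempty_inter_closedPoints hVne hV.isLocallyClosed
  obtain ⟨v, rfl⟩ := exists_toPoint_eq hvc
  intro U hU
  rw [isOpen_iff_forall_mem_open]
  rintro _ ⟨g, hg, rfl⟩
  -- Left translation by `h` carries `g` to `v`, a point near which `π` is open; equivariance brings
  -- the openness back to `g`.
  let h := v * g⁻¹
  obtain ⟨W, hW, hWU⟩ := isOpen_induced_iff.1 (hU.preimage (continuous_const_mul h⁻¹))
  have hVW : IsOpen (V ∩ W) := hV.inter hW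
  have himg := image_toPoint_preimage π (NoetherianSpace.isConstructible_of_isOpen hVW)
  have hN : IsOpen ((fun x : Pts G ↦ x ≫ π) '' (Pts.toPoint ⁻¹' (V ∩ W))) := by
    rw [himg]
    exact (hVf _ inter_subset_left hVW).preimage continuous_induced_dom
  refine ⟨_, ?_, hN.preimage (continuous_smul_pts h), ?_⟩
  · rintro x ⟨w, ⟨-, hw⟩, hwx⟩
    have hwU : w ∈ (h⁻¹ * ·) ⁻¹' U := hWU ▸ hw
    refine ⟨h⁻¹ * w, hwU, ?_⟩
    simp only [π, comp_orbitMap] at hwx ⊢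
    rw [mul_smul, hwx, inv_smul_smul]
  · have hvW : v ∈ Pts.toPoint ⁻¹' W := by
      rw [hWU]
      simpa [h] using hg
    refine ⟨v, ⟨hvV, hvW⟩, ?_⟩
    simp only [π, comp_orbitMap]
    rw [smul_smul]
    simp [h]

end OrbitMap

/-! ### Chains as products of transporter elements. -/

section Chains

variable {G X Z : SchC} [GrpObj G] [ModObj G X]

theorem IsHomogeneousSpace.proj_smul {H : Subgroup (Pts G)} {o : Pts X}
    (hX : IsHomogeneousSpace G X H o) {K : Subgroup (Pts G)} (hHK : H ≤ K) (g : Pts G) :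
    hX.proj hHK (g • o) = (g : Pts G ⧸ K) := by
  rw [IsHomogeneousSpace.proj, hX.cosetEquiv_smul]
  rfl

theorem IsHomogeneousSpace.proj_smul_eq_iff {H : Subgroup (Pts G)} {o : Pts X}
    (hX : IsHomogeneousSpace G X H o) {K : Subgroup (Pts G)} (hHK : H ≤ K) (g₁ g₂ : Pts G) :
    hX.proj hHK (g₁ • o) = hX.proj hHK (g₂ • o) ↔ g₁⁻¹ * g₂ ∈ K := by
  rw [hX.proj_smul, hX.proj_smul, QuotientGroup.eq]

/-- A sequence of points, consecutive ones being joined by a translate of `Z`, gives a chain. -/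
theorem exists_zChain_of_path (u : Z ⟶ X) (r : ℕ) (p : ℕ → Pts X)
    (hp : ∀ i < r, ∃ (a b : Pts Z) (g : Pts G),
      translatePt u g a = p i ∧ translatePt u g b = p (i + 1)) :
    ∃ c : ZChain G u r, c.Connects (p 0) (p r) := by
  choose a b g ha hb using hp
  refine ⟨⟨fun i ↦ a i i.2, fun i ↦ b i i.2, fun i ↦ g i i.2, fun i j hij ↦ ?_⟩,
    fun i hi ↦ ?_, fun i hi ↦ ?_, fun hr ↦ by rw [hr]⟩
  · rw [hb i i.2, ha j j.2, hij]
  · simp only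
    rw [ha i i.2, hi]
  · simp only
    rw [hb i i.2, hi]

/-- The elements of `G` that move `o` into the image of `Z`. -/
def transporter (G : SchC) {X Z : SchC} [GrpObj G] [ModObj G X] (u : Z ⟶ X) (o : Pts X) :
    Set (Pts G) :=
  {g | g • o ∈ range fun z : Pts Z ↦ z ≫ u}

theorem exists_path_of_mem_pow (u : Z ⟶ X) (o : Pts X) (g : Pts G) (n : ℕ) :
    ∀ t ∈ ((transporter G u o)⁻¹ * transporter G u o : Set (Pts G)) ^ n, ∃ p : ℕ → Pts X,
      p 0 = g • o ∧ p n = (g * t) • o ∧ ∀ i < n, ∃ (a b : Pts Z) (k : Pts G),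
        translatePt u k a = p i ∧ translatePt u k b = p (i + 1) := by
  induction n with
  | zero =>
    intro t ht
    obtain rfl : t = 1 := by simpa using ht
    exact ⟨fun _ ↦ g • o, rfl, by simp, by simp⟩
  | succ n ih =>
    intro t ht
    rw [pow_succ] at ht
    obtain ⟨t', ht', _, ⟨s, ⟨a, ha⟩, s', ⟨b, hb⟩, rfl⟩, rfl⟩ := ht
    obtain ⟨p, hp0, hpn, hp⟩ := ih t' ht'
    refine ⟨Function.update p (n + 1) ((g * (t' * (s * s'))) • o), by simpa using hp0, by simp,
      fun i hi ↦ ?_⟩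
    rcases Nat.lt_succ_iff_lt_or_eq.1 hi with hi | rfl
    · rw [Function.update_of_ne (by lia), Function.update_of_ne (by lia)]
      exact hp i hi
    · rw [Function.update_of_ne (by lia), Function.update_self]
      -- Here `s ∈ S⁻¹`, so `s⁻¹ • o = u(a)`, and translation by `g * t' * s` moves `u(a)` to the
      -- previous endpoint `(g * t') • o`.
      refine ⟨a, b, g * t' * s, ?_, ?_⟩
      · simp only at ha
        rw [translatePt, ha, hpn, smul_smul]
        simp
      · simp only at hb
        rw [translatePt, hb, smul_smul]
        simp [_root_.mul_assoc]

theorem exists_zChain_of_mem_pow_mul (u : Z ⟶ X) (o : Pts X) {g₁ g₂ : Pts G} {n : ℕ}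
    (h : g₁⁻¹ * g₂ ∈ ((transporter G u o)⁻¹ * transporter G u o : Set (Pts G)) ^ n *
      (MulAction.stabilizer (Pts G) o : Set (Pts G))) :
    ∃ c : ZChain G u n, c.Connects (g₁ • o) (g₂ • o) := by
  obtain ⟨t, ht, k, hk, htk⟩ := h
  obtain ⟨p, hp0, hpn, hp⟩ := exists_path_of_mem_pow u o g₁ n t ht
  obtain ⟨c, hc⟩ := exists_zChain_of_path u n p hp
  have hg₂ : g₂ = g₁ * t * k := by
    simp only at htk
    rw [_root_.mul_assoc, htk, mul_inv_cancel_left]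
  refine ⟨c, ?_⟩
  have hk' : k • o = o := hk
  rwa [hg₂, mul_smul, hk', ← hpn, ← hp0]

/-- If a function on `X` takes the same value at any two points of a translate of the image of
`Z`, then it takes the same value at the ends of a chain. -/
theorem ZChain.Connects.apply_eq {u : Z ⟶ X} {r : ℕ} {c : ZChain G u r} {x y : Pts X}
    (hc : c.Connects x y) {α : Type*} (f : Pts X → α)
    (hf : ∀ (g : Pts G) (a b : Pts Z), f (translatePt u g a) = f (translatePt u g b)) :
    f x = f y := by
  rcases Nat.eq_zero_or_pos r with hr | hr
  · rw [hc.2.2 hr]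
  · have h : ∀ n (hn : n < r), f (translatePt u (c.τ ⟨n, hn⟩) (c.b ⟨n, hn⟩)) = f x := by
      intro n
      induction n with
      | zero =>
        intro hn
        rw [← hc.1 ⟨0, hn⟩ rfl]
        exact hf _ _ _
      | succ n ih =>
        intro hn
        rw [← ih (by lia), c.link ⟨n, by lia⟩ ⟨n + 1, hn⟩ rfl]
        exact hf _ _ _
    rw [← hc.2.1 ⟨r - 1, by lia⟩ (by simp only; lia)]
    exact (h _ _).symm

attribute [local instance] zariskiTopology

theorem exists_zariskiDim_eq {G : SchC} [LocallyOfFiniteType G.hom] [QuasiCompact G.hom]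
    {S : Set (Pts G)} (hS : S.Nonempty) : ∃ d : ℕ, zariskiDim S = d := by
  have h1 : zariskiDim S < ⊤ :=
    (topologicalKrullDim_subspace_le _ S).trans_lt (topologicalKrullDim_pts_lt_top G)
  have h2 : zariskiDim S ≠ ⊥ := by
    obtain ⟨x, hx⟩ := hS
    have : Nonempty (IrreducibleCloseds S) :=
      ⟨⟨closure {⟨x, hx⟩}, isIrreducible_singleton.closure, isClosed_closure⟩⟩
    exact Order.krullDim_ne_bot_iff.2 this
  generalize zariskiDim S = d at h1 h2
  induction d with
  | bot => exact absurd rfl h2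
  | coe d =>
    lift d to ℕ using (WithBot.coe_lt_coe.1 h1).ne
    exact ⟨d, rfl⟩

theorem nonempty_pts (Z : SchC) [IsIrreducibleVariety Z] : Nonempty (Pts Z) :=
  have : LocallyOfFiniteType Z.hom := IsIrreducibleVariety.locallyOfFiniteType
  have : IsIntegral Z.left := IsIrreducibleVariety.isIntegral
  isIrreducible_univ_pts.nonempty.to_type

/-- The subgroup `K` generated by `H` and the differences of elements of `G` that move `o` into the
image of `Z` is closed, and its elements are products of a bounded number of such differences. -/
theorem exists_closed_subgroup_transporter
    (G X Z : SchC) [GrpObj G] [IsAlgebraicGroup G] [ModObj G X] [IsIrreducibleVariety Z]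
    (H : Subgroup (Pts G)) (o : Pts X)
    (hX : IsHomogeneousSpace G X H o) (hqp : IsQuasiProjective X) (u : Z ⟶ X) :
    ∃ K : Subgroup (Pts G), H ≤ K ∧ IsClosed (K : Set (Pts G)) ∧
      (transporter G u o)⁻¹ * transporter G u o ⊆ (K : Set (Pts G)) ∧
      ∃ n : ℕ, zariskiDim (H : Set (Pts G)) + n ≤ zariskiDim (K : Set (Pts G)) ∧
        (K : Set (Pts G)) ⊆ ((transporter G u o)⁻¹ * transporter G u o) ^ (2 * n) * H := by
  have : LocallyOfFiniteType G.hom := IsAlgebraicGroup.locallyOfFiniteType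
  have : QuasiCompact G.hom := IsAlgebraicGroup.quasiCompact
  have : LocallyOfFiniteType Z.hom := IsIrreducibleVariety.locallyOfFiniteType
  have : QuasiCompact Z.hom := IsIrreducibleVariety.quasiCompact
  have : IsIntegral Z.left := IsIrreducibleVariety.isIntegral
  have := hqp.locallyOfFiniteType
  have := hqp.quasiCompact
  have := hX.isReduced
  have := hX.transitive
  have := separatelyContinuousMul_pts G
  have := continuousInv_pts G
  have := noetherianSpace_pts G
  have horb : Continuous fun g : Pts G ↦ g • o := by
    convert continuous_comp (orbitMap o : G ⟶ X) using 2
    exact (comp_orbitMap o _).symm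
  have hopen : IsOpenMap fun g : Pts G ↦ g • o := isOpenMap_smul_pts o
  have hZ : IsIrreducible (univ : Set (Pts Z)) := isIrreducible_univ_pts
  have hR : IsIrreducible (range fun z : Pts Z ↦ z ≫ u) := by
    rw [← image_univ]
    exact hZ.image _ (continuous_comp u).continuousOn
  set S : Set (Pts G) := transporter G u o with hS
  have hSc : IsConstructible S := by
    refine NoetherianSpace.isConstructible_preimage horb ?_
    rw [← image_univ]
    exact isConstructible_image u .univ
  have hH : IsClosed (H : Set (Pts G)) := by
    rw [← hX.stabilizer_eq]
    exact (isClosed_singleton_pts o).preimage horb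
  have hHo : ∀ h ∈ H, h • o = o := fun h hh ↦ by rwa [← hX.stabilizer_eq] at hh
  have hSH : S * H ⊆ S := by
    rintro _ ⟨s, hs, h, hh, rfl⟩
    change (s * h) • o ∈ range fun z : Pts Z ↦ z ≫ u
    rw [mul_smul, hHo h hh]
    exact hs
  have hirr : ∀ 𝒯 : Set (Set (Pts G)), 𝒯.Finite → (∀ t ∈ 𝒯, t * (H : Set (Pts G)) ⊆ t ∧
      ∃ C, IsClosed C ∧ t = S ∩ C) → S ⊆ ⋃₀ 𝒯 → ∃ t ∈ 𝒯, S ⊆ t := by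
    intro 𝒯 hfin ht hcov
    have ht2 := fun t h𝒯 ↦ (ht t h𝒯).2
    choose! C hC htC using ht2
    -- This is the set of points all of whose lifts lie in `C t`, closed because the orbit map is
    -- open. By `H`-stability one lift in `t` puts a point of `u(Z)` there, so these sets cover
    -- `u(Z)`.
    have hclosed : ∀ t ∈ 𝒯, IsClosed ((fun g : Pts G ↦ g • o) '' (C t)ᶜ)ᶜ := fun t h𝒯 ↦
      (hopen _ (hC t h𝒯).isOpen_compl).isClosed_compl
    obtain ⟨_, hD, hRD⟩ := isIrreducible_iff_sUnion_isClosed.1 hR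
      ((hfin.image fun t ↦ ((fun g : Pts G ↦ g • o) '' (C t)ᶜ)ᶜ).toFinset) (by
        intro D hD
        obtain ⟨t, h𝒯, rfl⟩ : ∃ t ∈ 𝒯, ((fun g : Pts G ↦ g • o) '' (C t)ᶜ)ᶜ = D := by
          rwa [Finite.mem_toFinset] at hD
        exact hclosed t h𝒯) (by
        intro x hx
        obtain ⟨g, rfl⟩ := MulAction.exists_smul_eq (Pts G) o x
        obtain ⟨t, h𝒯, hgt⟩ := hcov hx
        refine ⟨_, (Finite.mem_toFinset _).2 (mem_image_of_mem _ h𝒯), ?_⟩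
        rintro ⟨g', hg', hgo⟩
        have hmem : g⁻¹ * g' ∈ H := by
          rw [← hX.stabilizer_eq, MulAction.mem_stabilizer_iff, mul_smul, inv_smul_eq_iff]
          exact hgo
        have h1 : g' ∈ t := (ht t h𝒯).1 ⟨g, hgt, g⁻¹ * g', hmem, by simp⟩
        rw [htC t h𝒯] at h1
        exact hg' h1.2)
    obtain ⟨t, h𝒯, rfl⟩ : ∃ t ∈ 𝒯, ((fun g : Pts G ↦ g • o) '' (C t)ᶜ)ᶜ = _ := by
      rwa [Finite.mem_toFinset] at hD
    refine ⟨t, h𝒯, fun g hg ↦ ?_⟩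
    rw [htC t h𝒯]
    refine ⟨hg, by_contra fun hgC ↦ hRD hg ⟨g, hgC, rfl⟩⟩
  exact exists_closed_subgroup (topologicalKrullDim_pts_lt_top G) isConstructible_mul_pts hH hSc
    hSH hirr

end Chains

end ChainsInHomogeneousSpaces

end

open scoped Pointwise in
theorem proposition1p2
    (G X Z : SchC) [GrpObj G] [IsAlgebraicGroup G] [ModObj G X] [IsIrreducibleVariety Z]
    (H : Subgroup (Pts G)) (o : Pts X)
    (hX : IsHomogeneousSpace G X H o) (hqp : IsQuasiProjective X) (u : Z ⟶ X) :
    ∃ (K : Subgroup (Pts G)) (hHK : H ≤ K),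
      IsClosed[zariskiTopology G] (K : Set (Pts G)) ∧
      (∀ x₁ x₂ : Pts X,
        (∃ r : ℕ, 1 ≤ r ∧ ∃ c : ZChain G u r, c.Connects x₁ x₂) ↔
          hX.proj hHK x₁ = hX.proj hHK x₂) ∧
      ∃ dimH dimK : ℕ,
        zariskiDim (H : Set (Pts G)) = dimH ∧ zariskiDim (K : Set (Pts G)) = dimK ∧
        ∀ x₁ x₂ : Pts X, hX.proj hHK x₁ = hX.proj hHK x₂ →
          ∃ r : ℕ, r ≤ 2 * (dimK - dimH) ∧ ∃ c : ZChain G u r, c.Connects x₁ x₂ := by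
  have : LocallyOfFiniteType G.hom := IsAlgebraicGroup.locallyOfFiniteType
  have : QuasiCompact G.hom := IsAlgebraicGroup.quasiCompact
  have := hX.transitive
  obtain ⟨K, hHK, hK, hTK, n, hdim, hKT⟩ := exists_closed_subgroup_transporter G X Z H o hX hqp u
  set S : Set (Pts G) := transporter G u o
  obtain ⟨dimH, hdimH⟩ := exists_zariskiDim_eq (S := (H : Set (Pts G))) ⟨1, H.one_mem⟩
  obtain ⟨dimK, hdimK⟩ := exists_zariskiDim_eq (S := (K : Set (Pts G))) ⟨1, K.one_mem⟩
  have hn : dimH + n ≤ dimK := by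
    rw [hdimH, hdimK] at hdim
    exact_mod_cast hdim
  have hchain : ∀ r, (K : Set (Pts G)) ⊆ (S⁻¹ * S) ^ r * (H : Set (Pts G)) → ∀ x₁ x₂ : Pts X,
      hX.proj hHK x₁ = hX.proj hHK x₂ → ∃ c : ZChain G u r, c.Connects x₁ x₂ := by
    intro r hr x₁ x₂ h
    obtain ⟨g₁, rfl⟩ := MulAction.exists_smul_eq (Pts G) o x₁
    obtain ⟨g₂, rfl⟩ := MulAction.exists_smul_eq (Pts G) o x₂
    rw [hX.proj_smul_eq_iff] at h
    refine exists_zChain_of_mem_pow_mul u o ?_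
    rw [hX.stabilizer_eq]
    exact hr h
  refine ⟨K, hHK, hK, fun x₁ x₂ ↦ ⟨?_, fun h ↦ ?_⟩, dimH, dimK, hdimH, hdimK, fun x₁ x₂ h ↦
    ⟨2 * n, by lia, hchain _ hKT x₁ x₂ h⟩⟩
  -- The projection is constant on each translate of `u(Z)`, because `S⁻¹ S ⊆ K`.
  · rintro ⟨r, -, c, hc⟩
    refine hc.apply_eq _ fun g a b ↦ ?_
    obtain ⟨s, hs⟩ := MulAction.exists_smul_eq (Pts G) o (a ≫ u)
    obtain ⟨s', hs'⟩ := MulAction.exists_smul_eq (Pts G) o (b ≫ u)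
    rw [translatePt, translatePt, ← hs, ← hs', smul_smul, smul_smul, hX.proj_smul_eq_iff]
    refine hTK ⟨s⁻¹, ?_, s', ⟨b, hs'.symm⟩, by group⟩
    simpa using ⟨a, hs.symm⟩
  -- For `n = 0` the length `2 * n` would give the empty chain. Since `Z` has a complex point, `1 ∈
  -- S⁻¹ S`, and a redundant link can be added.
  · refine ⟨2 * n + 1, by lia, hchain _ (hKT.trans ?_) x₁ x₂ h⟩
    obtain ⟨z⟩ := nonempty_pts Z
    obtain ⟨s, hs⟩ := MulAction.exists_smul_eq (Pts G) o (z ≫ u)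
    have hsS : s ∈ S := ⟨z, hs.symm⟩
    refine Set.mul_subset_mul_right (Set.pow_subset_pow_right ⟨s⁻¹, by simpa using hsS, s, hsS, by simp⟩
      (Nat.le_succ _))
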